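/- Recall the Open Coloring Axiom (OCA): for every set of reals $X$ and every partition $[X]^2=K_0\cup K_1$ of the set of two-element subsets of $X$ such that $K_0$ is open (that is, $\{(x,y)\in X\times X: x\neq y,\ \{x,y\}\in K_0\}$ is open in $X\times X$), either there is an uncountable set $Y\subseteq X$ with $[Y]^2\subseteq K_0$, or $X=\bigcup_{n\in\omega}A_n$ for some sets $A_n$ with $[A_n]^2\subseteq K_1$ for all $n$. A topological space $X$ is cosmic if it is a continuous image of a separable metrizable space; it is cometrizable if it admits a weaker (that is, coarser or equal) metrizable topology $\tau$ such that each point of $X$ has a (not necessarily open) neighborhood base in $X$ consisting of $\tau$-closed sets. The spread of $X$ is $s(X)=\sup\{|D| : D\subseteq X \text{ is a discrete subspace of } X\}$. Assume OCA. Let $G$ be a cometrizable topological group. Then $G$ is cosmic if and only if $s(G)\le\aleph_0$, i.e. $G$ has countable spread. -/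

import Mathlib

open scoped Topology Cardinal

universe u

/-- The Open Coloring Axiom. A coloring `[X]² = K₀ ∪ K₁` of the two-element subsets of a set of
reals `X` is given by a symmetric relation `r` on `X`, with `{x, y} ∈ K₀` iff `r x y` (for `x ≠ y`);
the values of `r` on the diagonal play no role. If `K₀` is open, then either there is an uncountable
`Y ⊆ X` with `[Y]² ⊆ K₀`, or `X` is a union of countably many sets `A n` with `[A n]² ⊆ K₁`. -/
def OpenColoringAxiom : Prop :=
  ∀ (X : Set ℝ) (r : X → X → Prop), (∀ x y, r x y → r y x) →
    IsOpen {p : X × X | p.1 ≠ p.2 ∧ r p.1 p.2} →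
    (∃ Y : Set X, ¬ Y.Countable ∧ Y.Pairwise r) ∨
    (∃ A : ℕ → Set X, (⋃ n, A n) = Set.univ ∧ ∀ n, (A n).Pairwise fun x y => ¬ r x y)

/-- The spread of a topological space: the supremum of the cardinalities of its discrete
subspaces. -/
noncomputable def spread (X : Type u) [TopologicalSpace X] : Cardinal.{u} :=
  ⨆ D : {D : Set X // DiscreteTopology D}, #(D : Set X)

/-- A space is cosmic if it is a continuous image of a separable metrizable space. (A separable
metrizable space has at most continuum many points, so the universe it is taken from does not
matter.) -/
def IsCosmic (X : Type u) [TopologicalSpace X] : Prop :=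
  ∃ (M : Type u) (_ : TopologicalSpace M) (f : M → X),
    TopologicalSpace.SeparableSpace M ∧ TopologicalSpace.MetrizableSpace M ∧
      Continuous f ∧ Function.Surjective f

/-- A space is cometrizable if it admits a weaker metrizable topology `τ` such that each point has a
neighborhood base (in the original topology) of `τ`-closed sets. In Mathlib's order on topologies,
`t ≤ τ` says that every `τ`-open set is `t`-open. -/
def IsCometrizable (X : Type u) [t : TopologicalSpace X] : Prop :=
  ∃ τ : TopologicalSpace X, t ≤ τ ∧ @TopologicalSpace.MetrizableSpace X τ ∧
    ∀ x : X, ∀ U ∈ @nhds X t x, ∃ C ∈ @nhds X t x, C ⊆ U ∧ IsClosed[τ] C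

/-!
A cosmic space is a continuous image of a second countable space, so its discrete subspaces are
countable. The converse is where OCA and the group structure enter.

Let `G` have countable spread and let `τ` be the coarser metrizable topology. It has countable
spread too, so it is second countable, and the pairs `(x, C)` with `C` a `τ`-closed neighbourhood of
`x` carry a second countable `T₀` topology in which `x ∉ D` is an open relation between `(x, C)` and
`(y, D)` (`exists_topology_isOpen_notMem`). OCA applies to open colorings of such spaces
(`OpenColoringAxiom.of_secondCountable`), and it is used three times.

* Color a pair by `x ∉ D ∨ y ∉ C`. If the pairs `(x, C)` split into countably many classes without
  this color, then the sets of points of these classes form a countable network, and `G` is cosmic.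
  Otherwise there is an uncountable set `Y` of pairs on which `x ∉ D ∨ y ∉ C` always holds
  (`ClosedNhd.exists_uncountable_of_not_isCosmic`).
* On `Y × Y`, consider couples of points at which the relation `x ∉ D` points one way on the first
  coordinate and the other way on the second one. A counting argument on vertical sections
  shows that `Y × Y` is not a countable union of sets free of such couples, so there is an
  uncountable `P ⊆ Y × Y` any two elements of which are opposed in this sense
  (`OpenColoringAxiom.exists_opposed_pairs`). For a subset of the Sorgenfrey line this is an
  uncountable decreasing partial function.
* Color by `x ∉ D ∧ y ∉ C`. An uncountable homogeneous set would be a discrete subspace, so the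
  pairs split into countably many classes on which `x ∈ D ∨ y ∈ C` always holds
  (`ClosedNhd.exists_countable_cover`). Applied to smaller neighbourhoods of the points in `P`, this
  turns the failure of `x ∈ D` into the closeness of `y` to `x`.

If `a` and `b` in `P` are opposed, then one of their coordinates moves away while the other one
stays close, whence the products `x_a x'_a⁻¹`, for `a` in an uncountable subset of `P`, form a
discrete subspace of `G`: a contradiction.
-/

open Set TopologicalSpace

/-! ### Countable spread and second countability -/

theorem Set.exists_not_countable_inter {ι : Type*} {I : Set ι} (hI : ¬ I.Countable)
    {A : ℕ → Set ι} (hA : I ⊆ ⋃ n, A n) : ∃ n, ¬ (I ∩ A n).Countable := by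
  by_contra! h
  refine hI ((countable_iUnion h).mono fun x hx => ?_)
  obtain ⟨n, hn⟩ := mem_iUnion.1 (hA hx)
  exact mem_iUnion.2 ⟨n, hx, hn⟩

theorem spread_le_aleph0_iff {X : Type u} [TopologicalSpace X] :
    spread X ≤ ℵ₀ ↔ ∀ D : Set X, DiscreteTopology D → D.Countable := by
  constructor
  · intro h D hD
    rw [← Cardinal.le_aleph0_iff_set_countable]
    exact (le_ciSup (f := fun D : {D : Set X // DiscreteTopology D} => #(D : Set X))
      (Cardinal.bddAbove_of_small) ⟨D, hD⟩).trans h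
  · intro h
    exact ciSup_le' fun D => Cardinal.le_aleph0_iff_set_countable.2 (h D.1 D.2)

/-- A family of points that admits neighbourhoods none of which contains another point of the
family is an injective enumeration of a discrete subspace. -/
theorem countable_of_pairwise_notMem_nhds {X : Type u} [TopologicalSpace X]
    (hX : ∀ D : Set X, DiscreteTopology D → D.Countable) {ι : Type*} {I : Set ι} (z : ι → X)
    (W : ι → Set X) (hW : ∀ i ∈ I, W i ∈ 𝓝 (z i)) (h : I.Pairwise fun i j => z i ∉ W j) :
    I.Countable := by
  have hinj : InjOn z I := by
    intro i hi j hj hij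
    by_contra hne
    exact h hi hj hne (hij ▸ mem_of_mem_nhds (hW j hj))
  refine countable_of_injective_of_countable_image hinj (hX _ ?_)
  rw [discreteTopology_subtype_iff']
  rintro _ ⟨i, hi, rfl⟩
  obtain ⟨O, hOW, hO, hiO⟩ := mem_nhds_iff.1 (hW i hi)
  refine ⟨O, hO, Subset.antisymm ?_ ?_⟩
  · rintro _ ⟨hj', j, hj, rfl⟩
    by_contra hne
    exact h hj hi (fun hji => hne (by simp [hji])) (hOW hj')
  · rintro _ rfl
    exact ⟨hiO, i, hi, rfl⟩

/-- For every `ε`, a maximal `ε`-separated set is discrete, hence countable. -/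
theorem secondCountableTopology_of_countable_discrete {X : Type u} [TopologicalSpace X]
    [MetrizableSpace X] (hX : ∀ D : Set X, DiscreteTopology D → D.Countable) :
    SecondCountableTopology X := by
  let := metrizableSpaceMetric X
  refine Metric.secondCountable_of_almost_dense_set fun ε hε => ?_
  obtain ⟨N, hN⟩ := zorn_subset {N : Set X | N.Pairwise fun x y => ε < dist x y} (by
    intro c hc hchain
    refine ⟨⋃₀ c, ?_, fun s hs => subset_sUnion_of_mem hs⟩
    exact (pairwise_sUnion hchain.directedOn).2 hc)
  refine ⟨N, ?_, fun x => ?_⟩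
  · refine countable_of_pairwise_notMem_nhds hX id (fun x => Metric.ball x ε)
      (fun x _ => Metric.ball_mem_nhds x hε) fun x hx y hy hne hxy => ?_
    exact (hN.prop hx hy hne).not_gt (Metric.mem_ball.1 hxy)
  · by_contra! h
    have hins : insert x N ⊆ N := hN.le_of_ge (by
      refine hN.prop.insert fun y hy _ => ⟨h y hy, ?_⟩
      rw [dist_comm]
      exact h y hy) (subset_insert x N)
    have := h x (hins (mem_insert x N))
    rw [dist_self] at this
    exact this.not_gt hε

/-! ### Cosmic spaces -/

theorem IsCosmic.countable_of_discrete {X : Type u} [TopologicalSpace X] (hX : IsCosmic X)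
    (D : Set X) (hD : DiscreteTopology D) : D.Countable := by
  obtain ⟨M, _, f, _, _, hf, hsurj⟩ := hX
  let := metrizableSpaceMetric M
  have : SecondCountableTopology M := UniformSpace.secondCountable_of_separable M
  obtain ⟨g, hg⟩ := hsurj.hasRightInverse
  have hcont : Continuous (MapsTo.restrict f (g '' D) D (by
      rintro _ ⟨x, hx, rfl⟩
      rwa [hg x])) := hf.restrict _
  have hinj : Function.Injective (MapsTo.restrict f (g '' D) D (by
      rintro _ ⟨x, hx, rfl⟩
      rwa [hg x])) := by
    rintro ⟨_, x, hx, rfl⟩ ⟨_, y, hy, rfl⟩ hxy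
    have : f (g x) = f (g y) := congrArg Subtype.val hxy
    rw [hg, hg] at this
    simp [this]
  have : DiscreteTopology (g '' D) := DiscreteTopology.of_continuous_injective hcont hinj
  have : Countable (g '' D) := TopologicalSpace.separableSpace_iff_countable.1 inferInstance
  exact countable_of_injective_of_countable_image hg.injective.injOn (to_countable (g '' D))

/-- A `T₀` space with a countable network is cosmic: retopologize it so that the members of the
network become clopen. -/
theorem isCosmic_of_countable_network {X : Type u} [TopologicalSpace X] [T0Space X]
    (N : ℕ → Set X) (hN : ∀ x, ∀ U ∈ 𝓝 x, ∃ n, x ∈ N n ∧ N n ⊆ U) : IsCosmic X := by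
  classical
  let χ : X → ℕ → Bool := fun x n => decide (x ∈ N n)
  have hχ : Function.Injective χ := by
    intro x y hxy
    have hmem (n : ℕ) : x ∈ N n ↔ y ∈ N n := by simpa [χ] using congrFun hxy n
    refine (inseparable_iff_forall_isOpen.2 fun U hU => ⟨fun h => ?_, fun h => ?_⟩).eq
    · obtain ⟨n, hn, hnU⟩ := hN x U (hU.mem_nhds h)
      exact hnU ((hmem n).1 hn)
    · obtain ⟨n, hn, hnU⟩ := hN y U (hU.mem_nhds h)
      exact hnU ((hmem n).2 hn)
  have hopen (U : Set X) (hU : IsOpen U) (x : X) (hx : x ∈ U) : ∃ n, N n ⊆ U ∧ x ∈ N n :=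
    (hN x U (hU.mem_nhds hx)).imp fun _ h => h.symm
  let σ : TopologicalSpace X := .induced χ inferInstance
  have hind : @Topology.IsEmbedding X (ℕ → Bool) σ _ χ :=
    @Topology.IsEmbedding.mk _ _ σ _ _ (@Topology.IsInducing.mk _ _ σ _ _ rfl) hχ
  refine ⟨X, σ, id, ?_, @Topology.IsEmbedding.metrizableSpace _ _ σ _ _ _ hind, ?_,
    Function.surjective_id⟩
  · have := secondCountableTopology_induced X (ℕ → Bool) χ
    exact @SecondCountableTopology.to_separableSpace _ σ this
  · refine continuous_def.2 fun U hU => ?_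
    refine isOpen_induced_iff.2 ⟨⋃ n ∈ {n | N n ⊆ U}, {f | f n = true}, ?_, ?_⟩
    · exact isOpen_biUnion fun n _ =>
        (isOpen_discrete {true}).preimage (f := fun f : ℕ → Bool => f n) (continuous_apply n)
    · ext x
      constructor
      · intro hx
        obtain ⟨n, hnU, hn⟩ : ∃ n, N n ⊆ U ∧ x ∈ N n := by simpa [χ] using hx
        exact hnU hn
      · intro hx
        simpa [χ] using hopen U hU x hx

/-! ### The Open Coloring Axiom in second countable spaces -/

/-- A second countable `T₀` space is the image of a set of reals under a continuous bijection:
send a point to the indicator sequence of a countable basis, seen as a point of the Cantor set. -/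
theorem exists_injective_real_induced_le (T : Type*) [t : TopologicalSpace T] [T0Space T]
    [SecondCountableTopology T] :
    ∃ e : T → ℝ, Function.Injective e ∧ TopologicalSpace.induced e inferInstance ≤ t := by
  classical
  obtain ⟨B, hBc, -, hB⟩ := exists_countable_basis T
  obtain ⟨b, hb⟩ := (hBc.insert ∅).exists_eq_range (insert_nonempty _ _)
  let χ : T → ℕ → Bool := fun x n => decide (x ∈ b n)
  have hle : TopologicalSpace.induced χ inferInstance ≤ t := by
    rw [hB.eq_generateFrom]
    refine le_generateFrom fun U hU => ?_
    obtain ⟨n, rfl⟩ : U ∈ range b := hb ▸ mem_insert_of_mem _ hU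
    refine isOpen_induced_iff.2 ⟨{f | f n = true}, ?_, by ext; simp [χ]⟩
    exact (isOpen_discrete {true}).preimage (f := fun f : ℕ → Bool => f n) (continuous_apply n)
  have hχ : Function.Injective χ := by
    intro x y hxy
    refine (hB.inseparable_iff.2 fun U hU => ?_).eq
    obtain ⟨n, rfl⟩ : U ∈ range b := hb ▸ mem_insert_of_mem _ hU
    simpa [χ] using congrFun hxy n
  let h := cantorSetHomeomorphNatToBool.symm
  refine ⟨fun x => (h (χ x) : ℝ), (Subtype.val_injective.comp h.injective).comp hχ, ?_⟩
  have hemb : Topology.IsInducing fun f => (h f : ℝ) :=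
    Topology.IsInducing.subtypeVal.comp h.isInducing
  change TopologicalSpace.induced ((fun f => (h f : ℝ)) ∘ χ) _ ≤ t
  rw [← induced_compose, ← hemb.eq_induced]
  exact hle

/-- OCA passes from sets of reals to second countable `T₀` spaces, because the bijection from a set
of reals pulls open colorings back to open colorings. -/
theorem OpenColoringAxiom.of_secondCountable (hOCA : OpenColoringAxiom) {T : Type*}
    [t : TopologicalSpace T] [T0Space T] [SecondCountableTopology T] (r : T → T → Prop)
    (hsymm : ∀ x y, r x y → r y x) (hr : IsOpen {p : T × T | r p.1 p.2}) :
    (∃ Y : Set T, ¬ Y.Countable ∧ Y.Pairwise r) ∨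
    (∃ A : ℕ → Set T, (⋃ n, A n) = univ ∧ ∀ n, (A n).Pairwise fun x y => ¬ r x y) := by
  obtain ⟨e, he, hle⟩ := exists_injective_real_induced_le T
  let f : T ≃ range e := Equiv.ofInjective e he
  have hf : Continuous f.symm := by
    refine ⟨fun U hU => ?_⟩
    obtain ⟨O, hO, rfl⟩ := isOpen_induced_iff.1 (hle U hU)
    convert hO.preimage continuous_subtype_val using 1
    ext ⟨_, x, rfl⟩
    have : f.symm ⟨e x, x, rfl⟩ = x := f.symm_apply_apply x
    simp [this]
  have hopen : IsOpen {p : range e × range e | p.1 ≠ p.2 ∧ r (f.symm p.1) (f.symm p.2)} :=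
    (isOpen_ne_fun continuous_fst continuous_snd).inter (hr.preimage (hf.prodMap hf))
  rcases hOCA (range e) (fun x y => r (f.symm x) (f.symm y)) (fun x y => hsymm _ _) hopen with
    ⟨Y, hY, hYr⟩ | ⟨A, hA, hAr⟩
  · refine Or.inl ⟨f.symm '' Y, fun hc =>
      hY (countable_of_injective_of_countable_image f.symm.injective.injOn hc), ?_⟩
    rintro _ ⟨x, hx, rfl⟩ _ ⟨y, hy, rfl⟩ hne
    exact hYr hx hy fun h => hne (h ▸ rfl)
  · refine Or.inr ⟨fun n => f ⁻¹' A n, by rw [← preimage_iUnion, hA, preimage_univ], ?_⟩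
    intro n x hx y hy hne
    simpa using hAr n hx hy (f.injective.ne hne)

/-- Let `S` be an open relation that compares any two distinct points of an uncountable second
countable space. Under OCA some uncountable set of pairs consists of pairs on which the comparisons
of first and of second coordinates point in opposite directions. -/
theorem OpenColoringAxiom.exists_opposed_pairs (hOCA : OpenColoringAxiom) {T : Type*}
    [TopologicalSpace T] [T0Space T] [SecondCountableTopology T] (hT : ¬ Countable T)
    (S : T → T → Prop) (hS : IsOpen {p : T × T | S p.1 p.2})
    (htotal : ∀ p q, p ≠ q → S p q ∨ S q p) :
    ∃ P : Set (T × T), ¬ P.Countable ∧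
      P.Pairwise fun a b => (S b.1 a.1 ∧ S a.2 b.2) ∨ (S a.1 b.1 ∧ S b.2 a.2) := by
  have hopen : IsOpen {p : (T × T) × (T × T) |
      (S p.2.1 p.1.1 ∧ S p.1.2 p.2.2) ∨ (S p.1.1 p.2.1 ∧ S p.2.2 p.1.2)} := by
    have key {f g : (T × T) × (T × T) → T} (hf : Continuous f) (hg : Continuous g) :
        IsOpen {p | S (f p) (g p)} := hS.preimage (hf.prodMk hg)
    exact ((key (by fun_prop) (by fun_prop)).inter (key (by fun_prop) (by fun_prop))).union
      ((key (by fun_prop) (by fun_prop)).inter (key (by fun_prop) (by fun_prop)))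
  refine (hOCA.of_secondCountable (fun a b : T × T =>
    (S b.1 a.1 ∧ S a.2 b.2) ∨ (S a.1 b.1 ∧ S b.2 a.2)) (fun a b h => h.symm) hopen).resolve_right ?_
  rintro ⟨A, hA, hAr⟩
  -- The sets `A n` cover `T × T` and contain no opposed pairs. Each vertical section of `T × T` is
  -- uncountable, so one `A n` holds two points `(p, a p)`, `(p, b p)` of it, with `S (b p) (a p)`.
  have hsection (p : T) : ∃ n a b, (p, a) ∈ A n ∧ (p, b) ∈ A n ∧ S b a := by
    obtain ⟨n, hn⟩ := exists_not_countable_inter (I := univ) (A := fun n => {a | (p, a) ∈ A n})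
      (fun h => hT (countable_univ_iff.1 h)) fun a _ => by
        have : (p, a) ∈ ⋃ n, A n := hA ▸ mem_univ _
        simpa using this
    obtain ⟨a, ⟨-, ha⟩, b, ⟨-, hb⟩, hab⟩ :
        (univ ∩ {a | (p, a) ∈ A n}).Nontrivial := by
      by_contra h
      exact hn (not_nontrivial_iff.1 h).countable
    rcases htotal a b hab with h | h
    · exact ⟨n, b, a, hb, ha, h⟩
    · exact ⟨n, a, b, ha, hb, h⟩
  choose n a b ha hb hba using hsection
  have hbasis := isBasis_countableBasis T
  have hbox (p : T) : ∃ U V : countableBasis T, b p ∈ U.1 ∧ a p ∈ V.1 ∧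
      ∀ x ∈ U.1, ∀ y ∈ V.1, S x y := by
    obtain ⟨_, ⟨U, hU, V, hV, rfl⟩, hmem, hsub⟩ :=
      (hbasis.prod hbasis).exists_subset_of_mem_open
        (show (b p, a p) ∈ {p : T × T | S p.1 p.2} from hba p) hS
    exact ⟨⟨U, hU⟩, ⟨V, hV⟩, hmem.1, hmem.2, fun x hx y hy => hsub (mk_mem_prod hx hy)⟩
  choose U V hbU haV hUV using hbox
  -- If `p ≠ q` share these countable data, then `S (b q) (a p)` and `S (b p) (a q)`, so neither
  -- comparison of `p` with `q` is possible.
  refine hT (Function.Injective.countable (f := fun p => (n p, U p, V p)) ?_)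
  intro p q hpq
  by_contra hne
  obtain ⟨hn, hU, hV⟩ : n p = n q ∧ U p = U q ∧ V p = V q := by simpa using hpq
  have h1 : S (b q) (a p) := hUV p _ (hU ▸ hbU q) _ (haV p)
  have h2 : S (b p) (a q) := hUV p _ (hbU p) _ (hV ▸ haV q)
  have h3 := hAr (n p) (ha p) (hn ▸ hb q) (by simp [hne])
  have h4 := hAr (n p) (hb p) (hn ▸ ha q) (by simp [hne])
  rcases htotal p q hne with h | h
  · exact h3 (Or.inr ⟨h, h1⟩)
  · exact h4 (Or.inl ⟨h, h2⟩)

/-! ### Points with closed neighbourhoods -/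

/-- A pair of a point and a closed set is coded by the point together with the set of members of a
countable basis that are disjoint from the closed set. -/
theorem exists_topology_isOpen_notMem {X T : Type*} [TopologicalSpace X] [T0Space X]
    [SecondCountableTopology X] (f : T → X × Set X) (hf : Function.Injective f)
    (hcl : ∀ p, IsClosed (f p).2) :
    ∃ _ : TopologicalSpace T, T0Space T ∧ SecondCountableTopology T ∧
      IsOpen {pq : T × T | (f pq.1).1 ∉ (f pq.2).2} := by
  classical
  have hB := isBasis_countableBasis X
  let c : T → X × (countableBasis X → Bool) :=
    fun p => ((f p).1, fun U => decide (Disjoint U.1 (f p).2))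
  have hmem (x : X) (p : T) : x ∉ (f p).2 ↔ ∃ U : countableBasis X, x ∈ U.1 ∧ (c p).2 U = true := by
    constructor
    · intro hx
      obtain ⟨U, hU, hxU, hsub⟩ := hB.exists_subset_of_mem_open hx (hcl p).isOpen_compl
      exact ⟨⟨U, hU⟩, hxU, by simpa [c] using disjoint_left.2 hsub⟩
    · rintro ⟨U, hxU, hU⟩
      exact disjoint_left.1 (by simpa [c] using hU) hxU
  have hc : Function.Injective c := by
    intro p q hpq
    refine hf (Prod.ext (congrArg (fun z => z.1) hpq :) (Set.ext fun x => ?_))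
    rw [← not_iff_not, hmem, hmem, hpq]
  let s : TopologicalSpace T := .induced c inferInstance
  have hcc : Continuous c := continuous_induced_dom
  refine ⟨s, (Topology.IsEmbedding.mk ⟨rfl⟩ hc).t0Space, secondCountableTopology_induced _ _ c, ?_⟩
  have : {pq : T × T | (f pq.1).1 ∉ (f pq.2).2} =
      ⋃ U : countableBasis X, {pq | (c pq.1).1 ∈ U.1} ∩ {pq | (c pq.2).2 U = true} := by
    ext ⟨p, q⟩
    simp [hmem, c]
  rw [this]
  refine isOpen_iUnion fun U => ((hB.isOpen U.2).preimage ?_).inter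
    ((isOpen_discrete {true}).preimage (f := fun pq : T × T => (c pq.2).2 U) ?_)
  · fun_prop
  · exact (continuous_apply U).comp (by fun_prop)

/-- Pairs `(x, C)` of a point `x` and a neighbourhood `C` of `x` in the topology of `X` that is
closed in a second topology `τ`. -/
def ClosedNhd (X : Type u) (τ : TopologicalSpace X) [TopologicalSpace X] : Type u :=
  {p : X × Set X // p.2 ∈ 𝓝 p.1 ∧ IsClosed[τ] p.2}

namespace ClosedNhd

variable {X : Type u} {τ : TopologicalSpace X} [TopologicalSpace X]

/-- The point of a pair in `ClosedNhd X τ`. -/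
def pt (p : ClosedNhd X τ) : X := p.1.1

/-- The neighbourhood of a pair in `ClosedNhd X τ`. -/
def nhd (p : ClosedNhd X τ) : Set X := p.1.2

theorem nhd_mem_nhds (p : ClosedNhd X τ) : p.nhd ∈ 𝓝 p.pt := p.2.1

theorem pt_mem_nhd (p : ClosedNhd X τ) : p.pt ∈ p.nhd := mem_of_mem_nhds p.nhd_mem_nhds

theorem exists_topology_isOpen_pt_notMem_nhd (hτ : @T0Space X τ)
    (hτ' : @SecondCountableTopology X τ) :
    ∃ _ : TopologicalSpace (ClosedNhd X τ), T0Space (ClosedNhd X τ) ∧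
      SecondCountableTopology (ClosedNhd X τ) ∧
      IsOpen {pq : ClosedNhd X τ × ClosedNhd X τ | pq.1.pt ∉ pq.2.nhd} :=
  @exists_topology_isOpen_notMem X (ClosedNhd X τ) τ hτ hτ' Subtype.val Subtype.val_injective
    fun p => p.2.2

/-- If `X` has countable spread, then under OCA the pairs split into countably many classes such
that of any two members of a class one has its point in the neighbourhood of the other. -/
theorem exists_countable_cover (hOCA : OpenColoringAxiom) (hτ : @T0Space X τ)
    (hτ' : @SecondCountableTopology X τ)
    (hX : ∀ D : Set X, DiscreteTopology D → D.Countable) :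
    ∃ A : ℕ → Set (ClosedNhd X τ), (⋃ n, A n) = univ ∧
      ∀ n, ∀ p ∈ A n, ∀ q ∈ A n, p.pt ∈ q.nhd ∨ q.pt ∈ p.nhd := by
  obtain ⟨_, _, _, hS⟩ := exists_topology_isOpen_pt_notMem_nhd hτ hτ'
  obtain ⟨A, hA, hAr⟩ := (hOCA.of_secondCountable
    (fun p q : ClosedNhd X τ => p.pt ∉ q.nhd ∧ q.pt ∉ p.nhd) (fun _ _ h => h.symm)
    (hS.inter (hS.preimage continuous_swap))).resolve_left (by
      rintro ⟨Y, hY, hYr⟩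
      exact hY (countable_of_pairwise_notMem_nhds hX pt nhd (fun p _ => p.nhd_mem_nhds)
        (hYr.mono' fun _ _ h => h.1)))
  refine ⟨A, hA, fun n p hp q hq => ?_⟩
  obtain rfl | hne := eq_or_ne p q
  · exact Or.inl p.pt_mem_nhd
  · have := hAr n hp hq hne
    tauto

/-- A cometrizable space that is not cosmic carries, under OCA, an uncountable family of pairs of
which any two are separated on at least one side. -/
theorem exists_uncountable_of_not_isCosmic [T0Space X] (hOCA : OpenColoringAxiom)
    (hτ : @T0Space X τ) (hτ' : @SecondCountableTopology X τ)
    (hbase : ∀ x : X, ∀ U ∈ 𝓝 x, ∃ C ∈ 𝓝 x, C ⊆ U ∧ IsClosed[τ] C) (hX : ¬ IsCosmic X) :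
    ∃ Y : Set (ClosedNhd X τ), ¬ Y.Countable ∧
      Y.Pairwise fun p q => p.pt ∉ q.nhd ∨ q.pt ∉ p.nhd := by
  obtain ⟨_, _, _, hS⟩ := exists_topology_isOpen_pt_notMem_nhd hτ hτ'
  refine (hOCA.of_secondCountable (fun p q : ClosedNhd X τ => p.pt ∉ q.nhd ∨ q.pt ∉ p.nhd)
    (fun _ _ h => h.symm) (hS.union (hS.preimage continuous_swap))).resolve_right ?_
  rintro ⟨A, hA, hAr⟩
  -- The sets of points of the classes `A n` form a network.
  refine hX (isCosmic_of_countable_network (fun n => pt '' A n) fun x U hU => ?_)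
  obtain ⟨C, hC, hCU, hCτ⟩ := hbase x U hU
  let p : ClosedNhd X τ := ⟨(x, C), hC, hCτ⟩
  obtain ⟨n, hn⟩ := mem_iUnion.1 (hA ▸ mem_univ p : p ∈ ⋃ n, A n)
  refine ⟨n, ⟨p, hn, rfl⟩, ?_⟩
  rintro _ ⟨q, hq, rfl⟩
  have hqp : q.pt ∈ p.nhd := by
    by_cases h : q = p
    · exact h ▸ q.pt_mem_nhd
    · have := hAr n hq hn h
      tauto
  exact hCU hqp

end ClosedNhd

/-! ### Topological groups -/

/-- Nontrivial direction of the equivalence. Here `τ` witnesses cometrizability; it precedes the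
group topology among the binders so that the latter is the one found by instance search. -/
theorem isCosmic_of_countable_discrete (hOCA : OpenColoringAxiom) {G : Type u}
    (τ : TopologicalSpace G) (hmet : MetrizableSpace G)
    [Group G] [t : TopologicalSpace G] [IsTopologicalGroup G] (hle : t ≤ τ)
    (hbase : ∀ x : G, ∀ U ∈ 𝓝 x, ∃ C ∈ 𝓝 x, C ⊆ U ∧ IsClosed[τ] C)
    (hD : ∀ D : Set G, DiscreteTopology D → D.Countable) : IsCosmic G := by
  obtain ⟨hτ2, hτ0⟩ : @T2Space G τ ∧ @T0Space G τ := by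
    let := @metrizableSpaceMetric G τ hmet
    exact ⟨inferInstance, inferInstance⟩
  have hτ' : @SecondCountableTopology G τ :=
    @secondCountableTopology_of_countable_discrete _ τ hmet fun D h =>
      hD D ⟨le_bot_iff.1 ((induced_mono hle).trans h.eq_bot.le)⟩
  have hG2 : T2Space G := t2Space_antitone hle hτ2
  by_contra hcosmic
  obtain ⟨Y, hY, hYr⟩ := ClosedNhd.exists_uncountable_of_not_isCosmic hOCA hτ0 hτ' hbase hcosmic
  obtain ⟨A, hA, hAr⟩ := ClosedNhd.exists_countable_cover hOCA hτ0 hτ' hD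
  obtain ⟨P, hP, hPr⟩ : ∃ P : Set (Y × Y), ¬ P.Countable ∧ P.Pairwise fun a b =>
      (b.1.1.pt ∉ a.1.1.nhd ∧ a.2.1.pt ∉ b.2.1.nhd) ∨
      (a.1.1.pt ∉ b.1.1.nhd ∧ b.2.1.pt ∉ a.2.1.nhd) := by
    obtain ⟨_, _, _, hS⟩ := ClosedNhd.exists_topology_isOpen_pt_notMem_nhd hτ0 hτ'
    exact hOCA.exists_opposed_pairs (T := Y) hY (fun p q => p.1.pt ∉ q.1.nhd)
      (hS.preimage (continuous_subtype_val.prodMap continuous_subtype_val))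
      fun p q hne => hYr p.2 q.2 (Subtype.val_injective.ne hne)
  -- For each `a` in `Y × Y` a single symmetric `V a` has to serve both coordinates.
  have hV (a : Y × Y) : ∃ V ∈ 𝓝 (1 : G), V⁻¹ = V ∧
      (∀ u ∈ V, ∀ v ∈ V, a.1.1.pt * (u * v) ∈ a.1.1.nhd) ∧
      ∀ u ∈ V, ∀ v ∈ V, a.2.1.pt * (u * v) ∈ a.2.1.nhd := by
    have key (p : ClosedNhd G τ) : (fun g => p.pt * g) ⁻¹' p.nhd ∈ 𝓝 (1 : G) :=
      (continuous_const_mul p.pt).continuousAt.preimage_mem_nhds (by simpa using p.nhd_mem_nhds)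
    obtain ⟨V, hV, -, hVinv, hsub⟩ :=
      exists_closed_nhds_one_inv_eq_mul_subset (Filter.inter_mem (key a.1.1) (key a.2.1))
    exact ⟨V, hV, hVinv, fun u hu v hv => (hsub (mul_mem_mul hu hv)).1,
      fun u hu v hv => (hsub (mul_mem_mul hu hv)).2⟩
  choose V hV1 hVinv hVl hVr using hV
  have hC (x : G) (a : Y × Y) : ∃ q : ClosedNhd G τ, q.pt = x ∧ ∀ y ∈ q.nhd, x⁻¹ * y ∈ V a := by
    obtain ⟨C, hC, hCU, hCτ⟩ := hbase x ((fun y => x⁻¹ * y) ⁻¹' V a)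
      ((continuous_const_mul x⁻¹).continuousAt.preimage_mem_nhds (by simpa using hV1 a))
    exact ⟨⟨(x, C), hC, hCτ⟩, rfl, hCU⟩
  choose l hlpt hl using fun a : Y × Y => hC a.1.1.pt a
  choose r hrpt hr using fun a : Y × Y => hC a.2.1.pt a
  -- Thin out `P` so that the refined neighbourhoods of the first coordinates lie in one class of
  -- the cover, and likewise those of the second coordinates.
  obtain ⟨m, hm⟩ := exists_not_countable_inter hP (A := fun n => l ⁻¹' A n)
    (by rw [← preimage_iUnion, hA]; exact subset_univ _)
  obtain ⟨n, hn⟩ := exists_not_countable_inter hm (A := fun n => r ⁻¹' A n)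
    (by rw [← preimage_iUnion, hA]; exact subset_univ _)
  -- Write `a = ((x_a, C_a), (x'_a, C'_a))`. If `x_b ∉ C_a` and `x'_a ∉ C'_b`, the refined
  -- neighbourhoods force `x_a ∈ x_b V_b` and `x'_b ∈ x'_a V_a`, which separates
  -- `x_a x'_a⁻¹` and `x_b x'_b⁻¹` from each other on both sides.
  have hsep : ∀ a ∈ P ∩ l ⁻¹' A m ∩ r ⁻¹' A n, ∀ b ∈ P ∩ l ⁻¹' A m ∩ r ⁻¹' A n,
      b.1.1.pt ∉ a.1.1.nhd → a.2.1.pt ∉ b.2.1.nhd →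
      a.1.1.pt⁻¹ * (b.1.1.pt * b.2.1.pt⁻¹) * a.2.1.pt ∉ V a ∧
      b.1.1.pt⁻¹ * (a.1.1.pt * a.2.1.pt⁻¹) * b.2.1.pt ∉ V b := by
    intro a ha b hb hfst hsnd
    have hVone (c : Y × Y) : (1 : G) ∈ V c := mem_of_mem_nhds (hV1 c)
    have hu : b.1.1.pt⁻¹ * a.1.1.pt ∈ V b := by
      rcases hAr m _ ha.1.2 _ hb.1.2 with h | h
      · exact hl b _ (hlpt a ▸ h)
      · refine absurd ?_ hfst
        simpa using hVl a _ (hl a _ (hlpt b ▸ h)) 1 (hVone a)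
    have hv : a.2.1.pt⁻¹ * b.2.1.pt ∈ V a := by
      rcases hAr n _ ha.2 _ hb.2 with h | h
      · refine absurd ?_ hsnd
        simpa using hVr b _ (hr b _ (hrpt a ▸ h)) 1 (hVone b)
      · exact hr a _ (hrpt b ▸ h)
    constructor
    · intro hw
      refine hfst ?_
      convert hVl a _ hw _ hv using 1
      group
    · intro hw
      refine hsnd ?_
      have hw' := inv_mem_inv.2 hw
      rw [hVinv] at hw'
      convert hVr b _ hw' _ hu using 1
      group
  refine hn (countable_of_pairwise_notMem_nhds hD (fun a => a.1.1.pt * a.2.1.pt⁻¹)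
    (fun a => (fun g => a.1.1.pt⁻¹ * g * a.2.1.pt) ⁻¹' V a) (fun a _ => ?_) ?_)
  · have hc : Continuous fun g : G => a.1.1.pt⁻¹ * g * a.2.1.pt := by fun_prop
    exact hc.continuousAt.preimage_mem_nhds (by simpa using hV1 a)
  · intro a ha b hb hne
    rcases hPr ha.1.1 hb.1.1 hne with h | h
    · exact (hsep a ha b hb h.1 h.2).2
    · exact (hsep b hb a ha h.1 h.2).1

theorem corollary4 (hOCA : OpenColoringAxiom) (G : Type u) [Group G] [TopologicalSpace G]
    [IsTopologicalGroup G] (hG : IsCometrizable G) :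
    IsCosmic G ↔ spread G ≤ ℵ₀ := by
  rw [spread_le_aleph0_iff]
  refine ⟨IsCosmic.countable_of_discrete, fun hD => ?_⟩
  rename_i t ht
  obtain ⟨τ, hle, hmet, hbase⟩ := hG
  exact @isCosmic_of_countable_discrete hOCA G τ hmet _ t ht hle hbase hD
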